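/- For $p\in\mathbb C$ with $|p|<1$ and $x\in\mathbb C\setminus\{0\}$ let $\theta(x;p)=\prod_{j\ge 0}(1-p^jx)(1-p^{j+1}/x)$ and $\theta(x_1,\dots,x_m;p)=\theta(x_1;p)\cdots\theta(x_m;p)$. For $a,b,q\in\mathbb C\setminus\{0\}$, $k\in\mathbb Z$ and $z\in\mathbb C$ put $$w_{a,b;q,p}(k)=\frac{\theta(aq^{2k+1},bq^k,aq^{k-2}/b;p)}{\theta(aq^{2k-1},bq^{k+2},aq^k/b;p)}\,q,\qquad [z]_{a,b;q,p}=\frac{\theta(q^z,aq^z,bq^2,a/b;p)}{\theta(q,aq,bq^{z+1},aq^{z-1}/b;p)},$$ where $q^z=\exp(z\log q)$ with the principal logarithm. Let $n\ge 0$, let $0\le b_1\le b_2\le\dots\le b_n\le n$ be integers, and let $B=B(b_1,\dots,b_n)=\{(i,j): 1\le i\le n,\ 1\le j\le b_i\}$ be the corresponding Ferrers board in $[n]\times[n]$, where $(i,j)$ is the cell in column $i$ from the left and row $j$ from the bottom. Let $\mathcal N_k(B)$ be the set of $k$-element subsets $P\subseteq B$ (placements of $k$ rooks) with no two cells in the same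 row or in the same column. A rook of $P$ cancels all cells to its right in its row and all cells below it in its column; $U_B(P)$ is the set of cells of $B\setminus P$ cancelled by no rook of $P$, and $r_{P,(i,j)}$ is the number of rooks $(i',j')\in P$ with $i'<i$ and $j'>j$. Define the elliptic rook numbers by $$r_k(a,b;q,p;B)=\sum_{P\in\mathcal N_k(B)}\ \prod_{(i,j)\in U_B(P)}w_{a,b;q,p}(i-j-r_{P,(i,j)}).$$ Then, for all $a,b,q\in\mathbb C\setminus\{0\}$, $p\in\mathbb C$ with $|p|<1$ and $z\in\mathbb C$ such that none of the following denominators vanishes: those of the elliptic numbers $[z+b_i-i+1]_{aq^{2(i-1-b_i)},bq^{i-1-b_i};q,p}$ and $[z-i+1]_{aq^{2(i-1)},bq^{i-1};q,p}$ for $1\le i\le n$, and those of the weights $w_{a,b;q,p}(i-j)$ for $(i,j)\in B$ (all weights that occur in the rook numbers of $B$ are among these), one has $$\prod_{i=1}^n [z+b_i-i+1]_{aq^{2(i-1-b_i)},\,bq^{i-1-b_i};q,p} =\sum_{k=0}^{n}r_{n-k}(a,b;q,p;B)\prod_{j=1}^k [z-j+1]_{aq^{2(j-1)},\,bq^{j-1};q,p}.$$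 -/

import Mathlib

noncomputable section

namespace EllipticRook

/-- The modified Jacobi theta function
`θ(x; p) = ∏_{j ≥ 0} (1 - p^j x) (1 - p^(j+1) / x)`, for `x ≠ 0` and `|p| < 1`. -/
def theta (x p : ℂ) : ℂ :=
  ∏' j : ℕ, (1 - p ^ j * x) * (1 - p ^ (j + 1) / x)

/-- The denominator `θ(a q^(2k-1), b q^(k+2), a q^k / b; p)` of the small elliptic weight. -/
def weightDen (a b q p : ℂ) (k : ℤ) : ℂ :=
  theta (a * q ^ (2 * k - 1)) p * theta (b * q ^ (k + 2)) p * theta (a * q ^ k / b) p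

/-- The small elliptic weight
`w_{a,b;q,p}(k) = θ(a q^(2k+1), b q^k, a q^(k-2) / b; p) /
  θ(a q^(2k-1), b q^(k+2), a q^k / b; p) * q`. -/
def weight (a b q p : ℂ) (k : ℤ) : ℂ :=
  theta (a * q ^ (2 * k + 1)) p * theta (b * q ^ k) p * theta (a * q ^ (k - 2) / b) p /
    weightDen a b q p k * q

/-- The denominator `θ(q, a q, b q^(z+1), a q^(z-1) / b; p)` of the elliptic number. -/
def numberDen (a b q p z : ℂ) : ℂ :=
  theta q p * theta (a * q) p * theta (b * q ^ (z + 1)) p * theta (a * q ^ (z - 1) / b) p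

/-- The elliptic number
`[z]_{a,b;q,p} = θ(q^z, a q^z, b q^2, a / b; p) / θ(q, a q, b q^(z+1), a q^(z-1) / b; p)`. -/
def number (a b q p z : ℂ) : ℂ :=
  theta (q ^ z) p * theta (a * q ^ z) p * theta (b * q ^ 2) p * theta (a / b) p /
    numberDen a b q p z

/-- The board `B(b₁, …, bₙ) = {(i, j) | 1 ≤ i ≤ n, 1 ≤ j ≤ bᵢ}`; `(i, j)` is the cell in
column `i` (from the left) and row `j` (from the bottom). -/
def board (n : ℕ) (h : ℕ → ℕ) : Finset (ℕ × ℕ) :=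
  (Finset.Icc 1 n).biUnion fun i => (Finset.Icc 1 (h i)).image fun j => (i, j)

/-- No two distinct rooks are in the same column or in the same row. -/
def Nonattacking (P : Finset (ℕ × ℕ)) : Prop :=
  ∀ c ∈ P, ∀ d ∈ P, c ≠ d → c.1 ≠ d.1 ∧ c.2 ≠ d.2

open Classical in
/-- The nonattacking placements of `k` rooks in the board `B`. -/
def placements (k : ℕ) (B : Finset (ℕ × ℕ)) : Finset (Finset (ℕ × ℕ)) :=
  (B.powersetCard k).filter Nonattacking

/-- The rook `r` cancels the cells to its right in its row and those below it in its column. -/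
def Cancels (r c : ℕ × ℕ) : Prop :=
  (c.2 = r.2 ∧ r.1 < c.1) ∨ (c.1 = r.1 ∧ c.2 < r.2)

open Classical in
/-- `U_B(P)`: the cells of `B - P` that are not cancelled by any rook of `P`. -/
def uncancelled (B P : Finset (ℕ × ℕ)) : Finset (ℕ × ℕ) :=
  (B \ P).filter fun c => ∀ r ∈ P, ¬ Cancels r c

/-- The number of rooks of `P` in the north-west region of the cell `c`. -/
def northWest (P : Finset (ℕ × ℕ)) (c : ℕ × ℕ) : ℕ :=
  (P.filter fun r => r.1 < c.1 ∧ c.2 < r.2).card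

/-- The elliptic rook number `r_k(a, b; q, p; B)`. -/
def rookNumber (a b q p : ℂ) (k : ℕ) (B : Finset (ℕ × ℕ)) : ℂ :=
  ∑ P ∈ placements k B, ∏ c ∈ uncancelled B P,
    weight a b q p ((c.1 : ℤ) - (c.2 : ℤ) - (northWest P c : ℤ))

end EllipticRook

end

/-!
The proof rests on two independent facts.

*Elliptic numbers.* Write `V l` for the elliptic number `[z - l]` with parameters `a q^(2l)`,
`b q^l` (`shiftedNumber`). All factors on both sides of the product formula are of this form, and
`shiftedNumber_sub_one` states the recurrence `V (l - 1) = 1 + w l * V l`. After clearing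
denominators it is the Weierstrass addition formula for the theta function (`theta_addition`), a
linear relation between three products `θ(α y) θ(β y)` with the same value `D = α β`. Each
product is a holomorphic function of `y ≠ 0` with `D y² f(p y) = f(y)`. This functional equation
is a two-term recurrence for the Laurent coefficients, so the solutions form a space of dimension at
most two (`eq_zero_of_quasiperiodic`), and the three products are linearly dependent. The
coefficients of the relation are found by evaluating at zeros of two of the products.

*Rook placements.* The product formula holds for any weight `w` and any `V` with this recurrence
(`sum_placementWeight_mul_prod`), by induction on the number of columns. A placement `P` of `m`
rooks on the first `n` columns cancels `m` cells of a new last column of height `H`. Its `H - m`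
free cells, from the top downwards, have weights `w (n + 1 - H)`, `w (n + 2 - H)`, …, whatever the
rows of the rooks are (`northWest_add_card_freeRows`). The extensions of `P` to the last column, by
one rook in a free cell or by none, therefore contribute
`∑_{s < H - m} ∏_{t < s} w (n + 1 - H + t) + ∏_{t < H - m} w (n + 1 - H + t) * V (n - m)`, which by
the recurrence is `V (n - H)` (`sum_prod_range_add_eq`), independently of `P`.
-/

noncomputable section

namespace EllipticRook

/-! ### The theta function -/

/-- The shifted factorial `(x; p)_∞ = ∏_{j ≥ 0} (1 - p^j x)`. -/
def infPochhammer (p x : ℂ) : ℂ :=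
  ∏' j : ℕ, (1 - p ^ j * x)

lemma summable_norm_pow_mul {p : ℂ} (hp : ‖p‖ < 1) (x : ℂ) :
    Summable fun j : ℕ => ‖-(p ^ j * x)‖ := by
  simpa [norm_mul, norm_pow] using
    (summable_geometric_of_lt_one (norm_nonneg p) hp).mul_right ‖x‖

lemma multipliable_one_sub_pow_mul {p : ℂ} (hp : ‖p‖ < 1) (x : ℂ) :
    Multipliable fun j : ℕ => 1 - p ^ j * x := by
  simpa [sub_eq_add_neg] using multipliable_one_add_of_summable (summable_norm_pow_mul hp x)

lemma infPochhammer_eq_one_sub_mul {p : ℂ} (hp : ‖p‖ < 1) (x : ℂ) :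
    infPochhammer p x = (1 - x) * infPochhammer p (p * x) := by
  have h : ∀ j : ℕ, 1 - p ^ (j + 1) * x = 1 - p ^ j * (p * x) := fun j => by ring
  rw [infPochhammer, tprod_eq_zero_mul' (by simpa only [h] using multipliable_one_sub_pow_mul hp _)]
  simp [h, infPochhammer]

lemma differentiable_infPochhammer {p : ℂ} (hp : ‖p‖ < 1) :
    Differentiable ℂ (infPochhammer p) := by
  intro x
  have hloc : HasProdLocallyUniformlyOn (fun (j : ℕ) (y : ℂ) => 1 + -(p ^ j * y))
      (fun y => ∏' j : ℕ, (1 + -(p ^ j * y))) (Metric.ball 0 (‖x‖ + 1)) := by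
    refine Summable.hasProdLocallyUniformlyOn_nat_one_add Metric.isOpen_ball
      ((summable_geometric_of_lt_one (norm_nonneg p) hp).mul_right (‖x‖ + 1))
      (.of_forall fun j y hy => ?_) (fun j => by fun_prop)
    have hy' : ‖y‖ ≤ ‖x‖ + 1 := by simpa using (Metric.mem_ball.1 hy).le
    rw [norm_neg, norm_mul, norm_pow]
    gcongr
  have hd := hloc.differentiableOn (.of_forall fun s => by
    simpa [Finset.prod_fn] using DifferentiableOn.finsetProd (fun _ _ => by fun_prop))
    Metric.isOpen_ball
  have := hd.differentiableAt (x := x) (Metric.isOpen_ball.mem_nhds (by simp))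
  simpa only [← sub_eq_add_neg] using! this

lemma theta_eq_infPochhammer_mul {p : ℂ} (hp : ‖p‖ < 1) (x : ℂ) :
    theta x p = infPochhammer p x * infPochhammer p (p / x) := by
  rw [theta, infPochhammer, infPochhammer, ← Multipliable.tprod_mul
    (multipliable_one_sub_pow_mul hp x) (multipliable_one_sub_pow_mul hp (p / x))]
  refine tprod_congr fun j => ?_
  ring

lemma theta_one {p : ℂ} (hp : ‖p‖ < 1) : theta 1 p = 0 := by
  rw [theta_eq_infPochhammer_mul hp, infPochhammer_eq_one_sub_mul hp]
  simp

lemma theta_inv {p x : ℂ} (hp : ‖p‖ < 1) (hx : x ≠ 0) : theta x⁻¹ p = -theta x p / x := by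
  rw [theta_eq_infPochhammer_mul hp, theta_eq_infPochhammer_mul hp,
    infPochhammer_eq_one_sub_mul hp x, infPochhammer_eq_one_sub_mul hp x⁻¹]
  simp only [div_eq_mul_inv, inv_inv]
  field_simp
  ring

/-- Quasi-periodicity of the theta function under `x ↦ p x`. -/
lemma theta_mul_self {p x : ℂ} (hp : ‖p‖ < 1) (hp0 : p ≠ 0) (hx : x ≠ 0) :
    x * theta (p * x) p = -theta x p := by
  have h : p / (p * x) = x⁻¹ := by field_simp
  rw [theta_eq_infPochhammer_mul hp, theta_eq_infPochhammer_mul hp x, h,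
    infPochhammer_eq_one_sub_mul hp x, infPochhammer_eq_one_sub_mul hp x⁻¹, div_eq_mul_inv]
  field_simp
  ring

lemma differentiableAt_theta {p x : ℂ} (hp : ‖p‖ < 1) (hx : x ≠ 0) :
    DifferentiableAt ℂ (fun y => theta y p) x := by
  simp only [theta_eq_infPochhammer_mul hp]
  have h1 := differentiable_infPochhammer hp
  refine (h1 x).mul ((h1 (p / x)).comp x ?_)
  exact (differentiableAt_const p).div differentiableAt_id hx

lemma theta_zero_nome (x : ℂ) : theta x 0 = 1 - x := by
  rw [theta_eq_infPochhammer_mul (by simp), infPochhammer_eq_one_sub_mul (by simp),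
    zero_div, zero_mul]
  simp [infPochhammer]

/-! ### Laurent coefficients of quasi-periodic functions -/

/-- A continuous function on a circle around `0` all of whose Laurent coefficients vanish is
zero, by Fourier analysis. -/
lemma eq_zero_of_circleIntegral_zpow_mul {f : ℂ → ℂ} (hf : ContinuousOn f {0}ᶜ) {r : ℝ}
    (hr : 0 < r) (h : ∀ n : ℤ, (∮ z in C(0, r), z ^ n * f z) = 0) {z : ℂ} (hz : ‖z‖ = r) :
    f z = 0 := by
  have : Fact (0 < 2 * Real.pi) := ⟨Real.two_pi_pos⟩
  have hr' : (r : ℂ) ≠ 0 := by exact_mod_cast hr.ne'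
  let g : C(AddCircle (2 * Real.pi), ℂ) :=
    ⟨fun x => f (r * (AddCircle.toCircle x : ℂ)), by
      refine hf.comp_continuous (by fun_prop) fun x => ?_
      simp [hr.ne']⟩
  have hg : ∀ x : ℝ, g (x : AddCircle (2 * Real.pi)) = f (circleMap 0 r x) := by
    intro x
    have : (2 * Real.pi / (2 * Real.pi) * x) = x := by field_simp
    simp only [g, ContinuousMap.coe_mk, AddCircle.toCircle_apply_mk, this, Circle.coe_exp,
      circleMap, zero_add]
  have hcoef : ∀ n : ℤ, fourierCoeff g n = 0 := by
    intro n
    rw [fourierCoeff_eq_intervalIntegral g n 0, zero_add]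
    have h1 := h (-n - 1)
    rw [circleIntegral] at h1
    have h2 : ∀ x : ℝ, @fourier (2 * Real.pi) (-n) x • g x =
        (r : ℂ) ^ n * Complex.I⁻¹ *
          (deriv (circleMap 0 r) x • (circleMap 0 r x ^ (-n - 1) * f (circleMap 0 r x))) := by
      intro x
      have hc : circleMap 0 r x ≠ 0 := circleMap_ne_center hr.ne'
      have h3 : circleMap 0 r x ^ (-n - 1) = circleMap 0 r x ^ (-n) * (circleMap 0 r x)⁻¹ := by
        rw [zpow_sub_one₀ hc]
      have h4 : @fourier (2 * Real.pi) (-n) x = (r : ℂ) ^ n * circleMap 0 r x ^ (-n) := by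
        rw [fourier_coe_apply, circleMap, zero_add, mul_zpow, ← mul_assoc, ← zpow_add₀ hr',
          add_neg_cancel, zpow_zero, one_mul, ← Complex.exp_int_mul]
        congr 1
        have : (Real.pi : ℂ) ≠ 0 := by exact_mod_cast Real.pi_ne_zero
        push_cast
        field_simp
      rw [hg, h3, h4, deriv_circleMap, smul_eq_mul, smul_eq_mul]
      field_simp
    simp only [h2]
    rw [intervalIntegral.integral_const_mul, h1]
    simp
  have hs := hasSum_fourier_series_of_summable (f := g) (by
    have : fourierCoeff g = 0 := funext hcoef
    rw [this]; exact summable_zero)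
  have hg0 : g = 0 := by
    refine hs.unique ?_
    simp [hcoef]
  have hz' : z = circleMap 0 r z.arg := by
    rw [circleMap, zero_add, ← hz, Complex.norm_mul_exp_arg_mul_I]
  rw [hz', ← hg, hg0]
  rfl

lemma circleIntegral_eq_of_differentiable {f : ℂ → ℂ} (hf : ∀ z ≠ 0, DifferentiableAt ℂ f z)
    {r R : ℝ} (hr : 0 < r) (hR : 0 < R) :
    (∮ z in C(0, R), f z) = ∮ z in C(0, r), f z := by
  have key : ∀ r R : ℝ, 0 < r → r ≤ R → (∮ z in C(0, R), f z) = ∮ z in C(0, r), f z := by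
    intro r R hr hle
    refine Complex.circleIntegral_eq_of_differentiable_on_annulus_off_countable hr hle
      Set.countable_empty ?_ ?_
    · rintro z ⟨-, hz⟩
      refine (hf z ?_).continuousAt.continuousWithinAt
      rintro rfl
      exact hz (by simpa using hr)
    · rintro z ⟨⟨-, hz⟩, -⟩
      refine hf z ?_
      rintro rfl
      exact hz (by simpa using hr.le)
  rcases le_total r R with h | h
  · exact key r R hr h
  · exact (key R r hR h).symm

/-- The substitution `z ↦ p z` in an integral over a circle around `0`. -/
lemma circleIntegral_norm_mul {f : ℂ → ℂ} {p : ℂ} (r : ℝ) :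
    (∮ z in C(0, ‖p‖ * r), f z) = p * ∮ z in C(0, r), f (p * z) := by
  have hmap : ∀ x : ℝ, circleMap 0 (‖p‖ * r) (x + p.arg) = p * circleMap 0 r x := by
    intro x
    conv_rhs => rw [← Complex.norm_mul_exp_arg_mul_I p]
    simp only [circleMap, zero_add]
    push_cast
    rw [add_mul, Complex.exp_add]
    ring
  simp only [circleIntegral, deriv_circleMap, smul_eq_mul]
  rw [← intervalIntegral.integral_const_mul]
  have hper : Function.Periodic (fun x : ℝ => circleMap 0 (‖p‖ * r) x * Complex.I *
      f (circleMap 0 (‖p‖ * r) x)) (2 * Real.pi) := fun x => by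
    simp only [periodic_circleMap 0 (‖p‖ * r) x]
  have h1 := hper.intervalIntegral_add_eq p.arg 0
  rw [zero_add] at h1
  rw [← h1]
  have h2 := intervalIntegral.integral_comp_add_right (a := 0) (b := 2 * Real.pi)
    (fun x : ℝ => circleMap 0 (‖p‖ * r) x * Complex.I * f (circleMap 0 (‖p‖ * r) x)) p.arg
  rw [zero_add, add_comm (2 * Real.pi)] at h2
  rw [← h2]
  simp only [hmap]
  congr 1
  ext x
  ring

/-- The functional equation `D z² f(p z) = f(z)` is the two-term recurrence
`c_(n+2) = D p^n c_n` for the Laurent coefficients of `f`. Hence `c_0 = c_1 = 0` forces `f = 0`: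
the solutions form a space of dimension at most two. -/
lemma eq_zero_of_quasiperiodic {f : ℂ → ℂ} {p D : ℂ} (hp0 : p ≠ 0) (hD : D ≠ 0)
    (hf : ∀ z ≠ 0, DifferentiableAt ℂ f z) (hq : ∀ z ≠ 0, D * z ^ 2 * f (p * z) = f z)
    (h0 : (∮ z in C(0, 1), z ^ (-1 : ℤ) * f z) = 0)
    (h1 : (∮ z in C(0, 1), z ^ (-2 : ℤ) * f z) = 0) {z : ℂ} (hz : z ≠ 0) : f z = 0 := by
  have hd : ∀ n : ℤ, ∀ z ≠ 0, DifferentiableAt ℂ (fun z => z ^ n * f z) z := fun n z hz =>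
    (differentiableAt_zpow.2 (Or.inl hz)).mul (hf z hz)
  have hrec : ∀ n : ℤ, D * (∮ z in C(0, 1), z ^ (n + 2) * f z) =
      p ^ (n + 3) * ∮ z in C(0, 1), z ^ n * f z := by
    intro n
    have h2 := circleIntegral_norm_mul (f := fun z => z ^ (n + 2) * f z) (p := p) 1
    rw [mul_one, circleIntegral_eq_of_differentiable (hd (n + 2)) one_pos (norm_pos_iff.2 hp0)] at h2
    rw [h2, ← circleIntegral.integral_const_mul, ← circleIntegral.integral_const_mul,
      ← circleIntegral.integral_const_mul]
    refine circleIntegral.integral_congr zero_le_one fun w hw => ?_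
    have hw0 : w ≠ 0 := by
      rintro rfl
      simp at hw
    simp only [← hq w hw0, mul_zpow, zpow_add₀ hp0, zpow_add₀ hw0]
    norm_cast
    ring
  have hstep : ∀ n : ℤ, (∮ z in C(0, 1), z ^ n * f z) = 0 ↔
      (∮ z in C(0, 1), z ^ (n + 2) * f z) = 0 := by
    intro n
    have h2 := hrec n
    constructor <;> intro h3 <;> rw [h3, mul_zero] at h2
    · exact (mul_eq_zero.1 h2).resolve_left hD
    · exact (mul_eq_zero.1 h2.symm).resolve_left (zpow_ne_zero _ hp0)
  have hall : ∀ n : ℤ, (∮ z in C(0, 1), z ^ n * f z) = 0 ∧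
      (∮ z in C(0, 1), z ^ (n + 1) * f z) = 0 := by
    intro n
    induction n using Int.induction_on with
    | zero =>
      have h2 := (hstep (-2)).1 h1
      have h3 := (hstep (-1)).1 h0
      norm_num at h2 h3 ⊢
      exact ⟨h2, h3⟩
    | succ n ih =>
      have h2 := (hstep n).1 ih.1
      exact ⟨ih.2, by rwa [add_assoc, one_add_one_eq_two]⟩
    | pred n ih =>
      have h2 := hstep (-n - 1)
      rw [show (-n - 1 + 2 : ℤ) = -n + 1 by ring] at h2
      exact ⟨h2.2 ih.2, by simpa using ih.1⟩
  -- The coefficients vanish on the unit circle, hence on the circle through `z`.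
  refine eq_zero_of_circleIntegral_zpow_mul
    (fun w hw => (hf w hw).continuousAt.continuousWithinAt) (norm_pos_iff.2 hz) (fun n => ?_) rfl
  rw [circleIntegral_eq_of_differentiable (hd n) one_pos (norm_pos_iff.2 hz)]
  exact (hall n).1

/-- Three solutions of the functional equation `D z² f(p z) = f(z)` are linearly dependent. -/
lemma exists_linear_relation_of_quasiperiodic {f : Fin 3 → ℂ → ℂ} {p D : ℂ} (hp0 : p ≠ 0)
    (hD : D ≠ 0) (hf : ∀ i, ∀ z ≠ 0, DifferentiableAt ℂ (f i) z)
    (hq : ∀ i, ∀ z ≠ 0, D * z ^ 2 * f i (p * z) = f i z) :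
    ∃ c : Fin 3 → ℂ, c ≠ 0 ∧ ∀ z ≠ 0, ∑ i, c i * f i z = 0 := by
  let M : Matrix (Fin 2) (Fin 3) ℂ := Matrix.of fun k i =>
    ∮ z in C(0, 1), z ^ (-1 - (k : ℤ)) * f i z
  obtain ⟨c, hc0, hc⟩ := (Submodule.ne_bot_iff _).1
    (LinearMap.ker_ne_bot_of_finrank_lt (f := Matrix.mulVecLin M) (by simp))
  rw [LinearMap.mem_ker, Matrix.mulVecLin_apply] at hc0
  refine ⟨c, hc, ?_⟩
  have hint : ∀ n : ℤ, (∮ z in C(0, 1), z ^ n * ∑ i, c i * f i z) =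
      ∑ i, (∮ z in C(0, 1), z ^ n * f i z) * c i := by
    intro n
    simp only [Finset.mul_sum]
    rw [circleIntegral.integral_fun_sum]
    · refine Finset.sum_congr rfl fun i _ => ?_
      rw [mul_comm _ (c i), ← circleIntegral.integral_const_mul]
      simp only [mul_left_comm]
    · refine fun i _ => ContinuousOn.circleIntegrable zero_le_one fun w hw => ?_
      have hw0 : w ≠ 0 := by
        rintro rfl
        simp at hw
      exact ((differentiableAt_zpow.2 (Or.inl hw0)).mul
        ((hf i w hw0).const_mul _)).continuousAt.continuousWithinAt
  refine fun z hz => eq_zero_of_quasiperiodic (f := fun z => ∑ i, c i * f i z) hp0 hD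
    (fun z hz => by
      have := fun i => hf i z hz
      fun_prop) (fun z hz => ?_) ?_ ?_ hz
  · rw [Finset.mul_sum]
    exact Finset.sum_congr rfl fun i _ => by rw [← hq i z hz]; ring
  · rw [hint]
    simpa [M, Matrix.mulVec, dotProduct] using congrFun hc0 0
  · rw [hint]
    simpa [M, Matrix.mulVec, dotProduct] using congrFun hc0 1

/-! ### The addition formula -/

/-- The quasi-periodicity of a product of two theta functions. -/
lemma theta_mul_theta_quasiperiodic {p α β z : ℂ} (hp : ‖p‖ < 1) (hp0 : p ≠ 0) (hα : α ≠ 0)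
    (hβ : β ≠ 0) (hz : z ≠ 0) :
    α * β * z ^ 2 * (theta (α * (p * z)) p * theta (β * (p * z)) p) =
      theta (α * z) p * theta (β * z) p := by
  have h1 := theta_mul_self hp hp0 (mul_ne_zero hα hz)
  have h2 := theta_mul_self hp hp0 (mul_ne_zero hβ hz)
  rw [mul_left_comm] at h1 h2
  linear_combination (β * z * theta (β * (p * z)) p) * h1 - theta (α * z) p * h2

/-- The Weierstrass addition formula for the theta function, in the form needed for the
recurrence of the elliptic numbers. For fixed `x`, `c`, `d` the three products are functions of
`y` obeying the same functional equation, so they are linearly dependent; the coefficients are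
read off at the zeros `y = 1` and `y = 1 / x` of two of the products. -/
lemma theta_addition {p x y c d : ℂ} (hp : ‖p‖ < 1) (hx : x ≠ 0) (hy : y ≠ 0) (hc : c ≠ 0)
    (hd : d ≠ 0) (hθx : theta x p ≠ 0) (hθc : theta c p ≠ 0) :
    theta (x * y) p * theta (c * y) p * theta (d * x) p * theta (c / d) p =
      theta x p * theta c p * theta (d * x * y) p * theta (c / d * y) p +
        x * theta d p * theta (c / (d * x)) p * theta y p * theta (c * x * y) p := by
  by_cases hp0 : p = 0
  · subst hp0
    simp only [theta_zero_nome]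
    field_simp
    ring
  have hcd : c / d ≠ 0 := div_ne_zero hc hd
  have hdiff : ∀ α β : ℂ, α ≠ 0 → β ≠ 0 → ∀ z ≠ 0,
      DifferentiableAt ℂ (fun z => theta (α * z) p * theta (β * z) p) z := by
    intro α β hα hβ z hz
    have h1 : ∀ γ : ℂ, γ ≠ 0 → DifferentiableAt ℂ (fun z => theta (γ * z) p) z := fun γ hγ =>
      (differentiableAt_theta hp (mul_ne_zero hγ hz)).comp z (by fun_prop)
    exact (h1 α hα).mul (h1 β hβ)
  obtain ⟨e, he, hrel⟩ := exists_linear_relation_of_quasiperiodic (p := p) (D := x * c)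
    (f := ![fun z => theta (x * z) p * theta (c * z) p,
      fun z => theta (d * x * z) p * theta (c / d * z) p,
      fun z => theta (1 * z) p * theta (c * x * z) p]) hp0 (mul_ne_zero hx hc)
    (by
      intro i
      fin_cases i
      · exact hdiff _ _ hx hc
      · exact hdiff _ _ (mul_ne_zero hd hx) hcd
      · exact hdiff _ _ one_ne_zero (mul_ne_zero hc hx))
    (by
      intro i z hz
      fin_cases i
      · exact theta_mul_theta_quasiperiodic hp hp0 hx hc hz
      · have := theta_mul_theta_quasiperiodic hp hp0 (mul_ne_zero hd hx) hcd hz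
        rwa [show d * x * (c / d) = x * c by field_simp] at this
      · have := theta_mul_theta_quasiperiodic hp hp0 one_ne_zero (mul_ne_zero hc hx) hz
        rwa [show 1 * (c * x) = x * c by ring] at this)
  simp only [Fin.sum_univ_three, Matrix.cons_val_zero, Matrix.cons_val_one, Matrix.cons_val,
    one_mul] at hrel
  have hrel1 := hrel 1 one_ne_zero
  have hrel2 := hrel x⁻¹ (inv_ne_zero hx)
  have hrely := hrel y hy
  rw [mul_inv_cancel_right₀ hx, mul_inv_cancel_right₀ hx, mul_inv_cancel₀ hx, theta_one hp,
    theta_inv hp hx, ← div_eq_mul_inv (c / d), div_div] at hrel2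
  simp only [mul_one, theta_one hp] at hrel1
  -- The coefficient of the second product cannot vanish.
  have he1 : e 1 ≠ 0 := by
    intro h1
    have h0 : e 0 = 0 := by
      simpa [h1, hθx, hθc] using hrel1
    have h2 : e 2 = 0 := by
      simpa [h1, hθx, hθc, hx] using hrel2
    refine he (funext fun i => ?_)
    fin_cases i <;> assumption
  have hrel2' : e 2 * theta x p * theta c p = x * (e 1 * (theta d p * theta (c / (d * x)) p)) := by
    rw [mul_comm d x]
    rw [mul_comm d x] at hrel2
    field_simp at hrel2
    linear_combination -hrel2
  refine mul_left_cancel₀ he1 ?_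
  linear_combination (theta (x * y) p * theta (c * y) p) * hrel1 -
    theta x p * theta c p * hrely + theta y p * theta (c * x * y) p * hrel2'

/-! ### One column -/

/-- Let `F` be a finite set of rows, and let each row carry the weight `g r` where `r` is the number
of rows of `F` above it. If a rook cancels the rows of `F` below it, then the sum over all
positions of the rook in `F`, and over the case of no rook with an extra factor `X`, depends only
on the size of `F`. -/
lemma sum_prod_filter_lt_add {R : Type*} [CommRing R] (g : ℕ → R) (X : R) (F : Finset ℕ) :
    ∑ j ∈ F, ∏ i ∈ F with j < i, g (F.filter (i < ·)).card +
        (∏ i ∈ F, g (F.filter (i < ·)).card) * X =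
      ∑ s ∈ Finset.range F.card, ∏ t ∈ Finset.range s, g t +
        (∏ t ∈ Finset.range F.card, g t) * X := by
  have key : ∑ j ∈ F, ∏ i ∈ F with j < i, g (F.filter (i < ·)).card =
        ∑ s ∈ Finset.range F.card, ∏ t ∈ Finset.range s, g t ∧
      ∏ i ∈ F, g (F.filter (i < ·)).card = ∏ t ∈ Finset.range F.card, g t := by
    induction F using Finset.induction_on_min with
    | empty => simp
    | insert m F hm ih =>
      have hmF : m ∉ F := fun h => lt_irrefl _ (hm m h)
      have h1 : ∀ i ∈ F, (insert m F).filter (i < ·) = F.filter (i < ·) := fun i hi => by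
        rw [Finset.filter_insert, if_neg (hm i hi).not_gt]
      have h2 : (insert m F).filter (m < ·) = F := by
        rw [Finset.filter_insert, if_neg (lt_irrefl m), Finset.filter_true_of_mem hm]
      have h3 : ∏ i ∈ F, g ((insert m F).filter (i < ·)).card =
          ∏ i ∈ F, g (F.filter (i < ·)).card :=
        Finset.prod_congr rfl fun i hi => by rw [h1 i hi]
      rw [Finset.sum_insert hmF, Finset.prod_insert hmF, Finset.card_insert_of_notMem hmF,
        Finset.sum_range_succ, Finset.prod_range_succ, h2, h3, ih.2, ← ih.1]
      refine ⟨?_, mul_comm _ _⟩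
      rw [add_comm]
      congr 1
      refine Finset.sum_congr rfl fun j hj => ?_
      rw [h1 j hj]
      exact Finset.prod_congr rfl fun i hi => by rw [h1 i (Finset.mem_filter.1 hi).1]
  rw [key.1, key.2]

/-- Iterating the recurrence `V (l - 1) = 1 + w l * V l`. -/
lemma sum_prod_range_add_eq {R : Type*} [CommRing R] {w V : ℤ → R} {l : ℤ} {c : ℕ}
    (hV : ∀ t < c, V (l + t - 1) = 1 + w (l + t) * V (l + t)) :
    ∑ s ∈ Finset.range c, ∏ t ∈ Finset.range s, w (l + t) +
      (∏ t ∈ Finset.range c, w (l + t)) * V (l + c - 1) = V (l - 1) := by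
  induction c with
  | zero => simp
  | succ c ih =>
    rw [← ih fun t ht => hV t (by omega), Finset.sum_range_succ, Finset.prod_range_succ,
      hV c (by omega)]
    push_cast
    rw [show l + ((c : ℤ) + 1) - 1 = l + c by ring]
    ring

/-! ### Adding a column to a board -/

lemma mem_board {n : ℕ} {h : ℕ → ℕ} {c : ℕ × ℕ} :
    c ∈ board n h ↔ (1 ≤ c.1 ∧ c.1 ≤ n) ∧ 1 ≤ c.2 ∧ c.2 ≤ h c.1 := by
  obtain ⟨i, j⟩ := c
  simp only [board, Finset.mem_biUnion, Finset.mem_image, Finset.mem_Icc, Prod.mk.injEq]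
  constructor
  · rintro ⟨_, hi, _, hj, rfl, rfl⟩
    exact ⟨hi, hj⟩
  · rintro ⟨hi, hj⟩
    exact ⟨i, hi, j, hj, rfl, rfl⟩

lemma mem_uncancelled {B P : Finset (ℕ × ℕ)} {c : ℕ × ℕ} :
    c ∈ uncancelled B P ↔ (c ∈ B ∧ c ∉ P) ∧
      ∀ r ∈ P, ¬ ((c.2 = r.2 ∧ r.1 < c.1) ∨ (c.1 = r.1 ∧ c.2 < r.2)) := by
  classical
  rw [uncancelled, Finset.mem_filter, Finset.mem_sdiff]
  rfl

/-- The weight of a placement `P` of rooks on the board `B`. -/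
def placementWeight {R : Type*} [CommRing R] (w : ℤ → R) (B P : Finset (ℕ × ℕ)) : R :=
  ∏ c ∈ uncancelled B P, w ((c.1 : ℤ) - (c.2 : ℤ) - (northWest P c : ℤ))

open Classical in
/-- The nonattacking placements of any number of rooks in the board `B`. -/
def allPlacements (B : Finset (ℕ × ℕ)) : Finset (Finset (ℕ × ℕ)) :=
  B.powerset.filter Nonattacking

lemma mem_allPlacements {B P : Finset (ℕ × ℕ)} :
    P ∈ allPlacements B ↔ P ⊆ B ∧ Nonattacking P := by
  simp [allPlacements]

/-- The rows `1, …, H` of a new last column of height `H` that contain no rook of `P`. The rooks of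
`P` lie to the left, so these are the rows of the column not cancelled by them. -/
def freeRows (H : ℕ) (P : Finset (ℕ × ℕ)) : Finset ℕ :=
  Finset.Icc 1 H \ P.image Prod.snd

lemma Nonattacking.subset {P Q : Finset (ℕ × ℕ)} (hP : Nonattacking P) (h : Q ⊆ P) :
    Nonattacking Q :=
  fun c hc d hd => hP c (h hc) d (h hd)

lemma mem_freeRows {H j : ℕ} {P : Finset (ℕ × ℕ)} :
    j ∈ freeRows H P ↔ (1 ≤ j ∧ j ≤ H) ∧ ∀ c ∈ P, c.2 ≠ j := by
  rw [freeRows, Finset.mem_sdiff, Finset.mem_Icc, Finset.mem_image]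
  exact and_congr_right fun _ => ⟨fun h c hc hcj => h ⟨c, hc, hcj⟩,
    fun h ⟨c, hc, hcj⟩ => h c hc hcj⟩

/-- The placements on the board with `n + 1` columns that restrict to a given placement `P` on
the first `n` columns: either the last column is empty, or it has one rook in a free row. -/
lemma filter_allPlacements_board_succ {n : ℕ} {h : ℕ → ℕ} {P : Finset (ℕ × ℕ)}
    (hP : P ∈ allPlacements (board n h)) :
    (allPlacements (board (n + 1) h)).filter (fun Q => Q.filter (fun c => c.1 ≤ n) = P) =
      insert P ((freeRows (h (n + 1)) P).image fun j => insert (n + 1, j) P) := by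
  obtain ⟨hPB, hPN⟩ := mem_allPlacements.1 hP
  have hcol : ∀ c ∈ P, c.1 ≤ n := fun c hc => (mem_board.1 (hPB hc)).1.2
  have hsub : ∀ c ∈ P, c ∈ board (n + 1) h := fun c hc => by
    have := mem_board.1 (hPB hc)
    exact mem_board.2 ⟨⟨this.1.1, by omega⟩, this.2⟩
  have hself : P.filter (fun c => c.1 ≤ n) = P := Finset.filter_true_of_mem hcol
  ext Q
  simp only [Finset.mem_filter, mem_allPlacements, Finset.mem_insert, Finset.mem_image,
    mem_freeRows]
  constructor
  · rintro ⟨⟨hQB, hQN⟩, hQP⟩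
    by_cases hex : ∃ c ∈ Q, c.1 = n + 1
    · obtain ⟨⟨i, j⟩, hc, rfl⟩ := hex
      right
      have hb := mem_board.1 (hQB hc)
      refine ⟨j, ⟨hb.2, fun d hd hdj => ?_⟩, ?_⟩
      · rw [← hQP, Finset.mem_filter] at hd
        refine (hQN d hd.1 _ hc ?_).2 hdj
        rintro rfl
        simp at hd
      · ext d
        rw [← hQP, Finset.mem_insert, Finset.mem_filter]
        constructor
        · rintro (rfl | hd)
          exacts [hc, hd.1]
        · intro hd
          by_cases hdc : d = (n + 1, j)
          · exact Or.inl hdc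
          · have := (hQN d hd _ hc hdc).1
            have := (mem_board.1 (hQB hd)).1.2
            exact Or.inr ⟨hd, by simp_all; omega⟩
    · left
      rw [← hQP, eq_comm]
      refine Finset.filter_true_of_mem fun c hc => ?_
      have := (mem_board.1 (hQB hc)).1.2
      have hne : c.1 ≠ n + 1 := fun h => hex ⟨c, hc, h⟩
      omega
  · rintro (rfl | ⟨j, ⟨hj, hjP⟩, rfl⟩)
    · exact ⟨⟨hsub, hPN⟩, hself⟩
    · refine ⟨⟨?_, ?_⟩, ?_⟩
      · rw [Finset.insert_subset_iff]
        exact ⟨mem_board.2 ⟨⟨by omega, le_rfl⟩, hj⟩, hsub⟩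
      · intro c hc d hd hcd
        rw [Finset.mem_insert] at hc hd
        rcases hc with rfl | hc <;> rcases hd with rfl | hd
        · exact absurd rfl hcd
        · have := hcol d hd
          exact ⟨by simp; omega, (hjP d hd).symm⟩
        · have := hcol c hc
          exact ⟨by simp; omega, hjP c hc⟩
        · exact hPN c hc d hd hcd
      · rw [Finset.filter_insert, if_neg (by simp), hself]

lemma northWest_insert_succ {n j : ℕ} {P : Finset (ℕ × ℕ)} {c : ℕ × ℕ} (hc : c.1 ≤ n + 1) :
    northWest (insert (n + 1, j) P) c = northWest P c := by
  rw [northWest, northWest, Finset.filter_insert, if_neg (by simp; omega)]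

/-- If `Q` extends the placement `P` to column `n + 1` and leaves the cells of the rows `F` of that
column uncancelled, then its weight is that of `P` times the weights of these cells. -/
lemma placementWeight_board_succ {R : Type*} [CommRing R] (w : ℤ → R) {n : ℕ} {h : ℕ → ℕ}
    {P Q : Finset (ℕ × ℕ)} {F : Finset ℕ}
    (hU : uncancelled (board (n + 1) h) Q =
      uncancelled (board n h) P ∪ F.image (fun j => (n + 1, j)))
    (hNW : ∀ c : ℕ × ℕ, c.1 ≤ n + 1 → northWest Q c = northWest P c) :
    placementWeight w (board (n + 1) h) Q = placementWeight w (board n h) P *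
      ∏ j ∈ F, w ((n + 1 : ℕ) - (j : ℤ) - (northWest P (n + 1, j) : ℤ)) := by
  have hb : ∀ c ∈ uncancelled (board n h) P, c.1 ≤ n := fun c hc => by
    simp only [mem_uncancelled, mem_board] at hc
    exact hc.1.1.1.2
  rw [placementWeight, hU, Finset.prod_union, Finset.prod_image (by simp)]
  · congr 1
    · exact Finset.prod_congr rfl fun c hc => by rw [hNW c (by have := hb c hc; omega)]
    · exact Finset.prod_congr rfl fun j _ => by rw [hNW _ le_rfl]
  · rw [Finset.disjoint_left]
    intro c hc hc'
    obtain ⟨j, -, rfl⟩ := Finset.mem_image.1 hc'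
    simpa using hb _ hc

lemma uncancelled_board_succ {n : ℕ} {h : ℕ → ℕ} {P : Finset (ℕ × ℕ)}
    (hPB : P ⊆ board n h) :
    uncancelled (board (n + 1) h) P =
      uncancelled (board n h) P ∪ (freeRows (h (n + 1)) P).image (fun j => (n + 1, j)) := by
  have hcol : ∀ c ∈ P, c.1 ≤ n := fun c hc => (mem_board.1 (hPB hc)).1.2
  ext ⟨i, j⟩
  simp only [mem_uncancelled, mem_board, Finset.mem_union, Finset.mem_image, mem_freeRows,
    Prod.mk.injEq]
  by_cases hi : i = n + 1
  · subst hi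
    constructor
    · rintro ⟨⟨⟨_, hj⟩, hP⟩, hc⟩
      refine Or.inr ⟨j, ⟨hj, fun c hcP hcj => hc c hcP (Or.inl ⟨hcj.symm, ?_⟩)⟩, rfl, rfl⟩
      exact Nat.lt_succ_of_le (hcol c hcP)
    · rintro (⟨⟨⟨h1, _⟩, _⟩, _⟩ | ⟨_, ⟨hj, hP⟩, -, rfl⟩)
      · simp at h1
      · refine ⟨⟨⟨by simp, hj⟩, fun hm => hP _ hm rfl⟩, ?_⟩
        rintro c hc (⟨h1, _⟩ | ⟨h1, _⟩)
        · exact hP c hc h1.symm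
        · have := hcol c hc
          omega
  · constructor
    · rintro ⟨⟨⟨h1, hj⟩, hP⟩, hc⟩
      exact Or.inl ⟨⟨⟨by omega, hj⟩, hP⟩, hc⟩
    · rintro (⟨⟨⟨h1, hj⟩, hP⟩, hc⟩ | ⟨_, _, h1, _⟩)
      · exact ⟨⟨⟨by omega, hj⟩, hP⟩, hc⟩
      · exact absurd h1.symm hi

lemma uncancelled_board_succ_insert {n j : ℕ} {h : ℕ → ℕ} {P : Finset (ℕ × ℕ)}
    (hPB : P ⊆ board n h) :
    uncancelled (board (n + 1) h) (insert (n + 1, j) P) = uncancelled (board n h) P ∪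
      ((freeRows (h (n + 1)) P).filter (j < ·)).image (fun j => (n + 1, j)) := by
  have h1 : uncancelled (board (n + 1) h) (insert (n + 1, j) P) =
      (uncancelled (board (n + 1) h) P).filter fun c => c.1 ≤ n ∨ j < c.2 := by
    ext ⟨i, k⟩
    simp only [Finset.mem_filter, mem_uncancelled, mem_board, Finset.mem_insert,
      forall_eq_or_imp, Prod.mk.injEq]
    constructor
    · rintro ⟨⟨⟨hi, hk⟩, hP⟩, hc, hc'⟩
      refine ⟨⟨⟨⟨hi, hk⟩, fun hh => hP (Or.inr hh)⟩, hc'⟩, ?_⟩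
      by_contra hcon
      have : ¬ (i = n + 1 ∧ k = j) := fun hh => hP (Or.inl hh)
      omega
    · rintro ⟨⟨⟨⟨hi, hk⟩, hP⟩, hc'⟩, hcon⟩
      refine ⟨⟨⟨hi, hk⟩, ?_⟩, by omega, hc'⟩
      rintro (hh | hh)
      · omega
      · exact hP hh
  rw [h1, uncancelled_board_succ hPB, Finset.filter_union, Finset.filter_image]
  congr 1
  · refine Finset.filter_true_of_mem fun c hc => Or.inl ?_
    simp only [mem_uncancelled, mem_board] at hc
    exact hc.1.1.1.2
  · simp

/-- Every row of the last column above row `j` either contains a rook of `P`, north-west of the cell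
in row `j`, or is free. Monotonicity of the heights ensures that all rooks of `P` lie in rows of
the last column. Hence the argument `n + 1 - j - r` of the weight of a cell of the last column
depends only on the number of free rows above it. -/
lemma northWest_add_card_freeRows {n j : ℕ} {h : ℕ → ℕ} {P : Finset (ℕ × ℕ)}
    (hP : P ∈ allPlacements (board n h)) (hmono : ∀ i, 1 ≤ i → i ≤ n → h i ≤ h (n + 1))
    (hj : j ≤ h (n + 1)) :
    j + northWest P (n + 1, j) + ((freeRows (h (n + 1)) P).filter (j < ·)).card = h (n + 1) := by
  obtain ⟨hPB, hPN⟩ := mem_allPlacements.1 hP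
  have hinj : Set.InjOn Prod.snd (P : Set (ℕ × ℕ)) := fun c hc d hd hcd => by
    by_contra hne
    exact (hPN c hc d hd hne).2 hcd
  have h1 : northWest P (n + 1, j) = ((P.image Prod.snd).filter (j < ·)).card := by
    rw [northWest, Finset.filter_image, Finset.card_image_of_injOn
      (hinj.mono fun c hc => (Finset.mem_filter.1 hc).1)]
    congr 1
    refine Finset.filter_congr fun c hc => ?_
    have := (mem_board.1 (hPB hc)).1.2
    simp; omega
  have h2 : Finset.Ioc j (h (n + 1)) = ((P.image Prod.snd).filter (j < ·)) ∪
      ((freeRows (h (n + 1)) P).filter (j < ·)) := by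
    ext k
    simp only [Finset.mem_Ioc, Finset.mem_union, Finset.mem_filter, mem_freeRows]
    constructor
    · rintro ⟨hk, hk'⟩
      by_cases hkP : k ∈ P.image Prod.snd
      · exact Or.inl ⟨hkP, hk⟩
      · refine Or.inr ⟨⟨⟨by omega, hk'⟩, fun c hc hck => hkP ?_⟩, hk⟩
        exact Finset.mem_image.2 ⟨c, hc, hck⟩
    · rintro (⟨hkP, hk⟩ | ⟨⟨⟨_, hk'⟩, _⟩, hk⟩)
      · obtain ⟨c, hc, rfl⟩ := Finset.mem_image.1 hkP
        have hb := mem_board.1 (hPB hc)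
        exact ⟨hk, hb.2.2.trans (hmono _ hb.1.1 hb.1.2)⟩
      · exact ⟨hk, hk'⟩
  have h3 := congrArg Finset.card h2
  rw [Finset.card_union_of_disjoint, Nat.card_Ioc] at h3
  · omega
  · rw [Finset.disjoint_left]
    intro k hk hk'
    obtain ⟨c, hc, rfl⟩ := Finset.mem_image.1 (Finset.mem_filter.1 hk).1
    exact (mem_freeRows.1 (Finset.mem_filter.1 hk').1).2 c hc rfl

lemma card_freeRows_add_card {n : ℕ} {h : ℕ → ℕ} {P : Finset (ℕ × ℕ)}
    (hP : P ∈ allPlacements (board n h)) (hmono : ∀ i, 1 ≤ i → i ≤ n → h i ≤ h (n + 1)) :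
    (freeRows (h (n + 1)) P).card + P.card = h (n + 1) := by
  have h1 := northWest_add_card_freeRows hP hmono (Nat.zero_le _)
  have h2 : northWest P (n + 1, 0) = P.card := by
    rw [northWest, Finset.filter_true_of_mem]
    intro c hc
    have := mem_board.1 ((mem_allPlacements.1 hP).1 hc)
    simp; omega
  rw [Finset.filter_true_of_mem fun j hj =>
    Nat.pos_of_ne_zero (Nat.one_le_iff_ne_zero.1 (mem_freeRows.1 hj).1.1)] at h1
  omega

/-- A nonattacking placement has at most one rook in each of the `n` columns. -/
lemma card_le_of_mem_allPlacements {n : ℕ} {h : ℕ → ℕ} {P : Finset (ℕ × ℕ)}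
    (hP : P ∈ allPlacements (board n h)) : P.card ≤ n := by
  obtain ⟨hPB, hPN⟩ := mem_allPlacements.1 hP
  have hcard : P.card ≤ (Finset.Icc 1 n).card := by
    refine Finset.card_le_card_of_injOn Prod.fst (fun c hc => ?_) fun c hc d hd hcd => ?_
    · simpa using (mem_board.1 (hPB hc)).1
    · by_contra hne
      exact (hPN c hc d hd hne).1 hcd
  simpa using hcard

/-! ### The product formula -/

/-- The contribution of the last column: the placements extending `P` to column `n + 1`
contribute the weight of `P` times a factor `V (n - h (n + 1))` that does not depend on `P`. -/
lemma sum_extensions {R : Type*} [CommRing R] {w V : ℤ → R} {n : ℕ} {h : ℕ → ℕ}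
    {P : Finset (ℕ × ℕ)} (hP : P ∈ allPlacements (board n h))
    (hmono : ∀ i, 1 ≤ i → i ≤ n → h i ≤ h (n + 1))
    (hV : ∀ j, 1 ≤ j → j ≤ h (n + 1) →
      V ((n + 1 : ℕ) - (j : ℤ) - 1) = 1 + w ((n + 1 : ℕ) - (j : ℤ)) * V ((n + 1 : ℕ) - (j : ℤ))) :
    ∑ Q ∈ allPlacements (board (n + 1) h) with Q.filter (fun c => c.1 ≤ n) = P,
        placementWeight w (board (n + 1) h) Q *
          ∏ j ∈ Finset.Icc 1 (n + 1 - Q.card), V ((j : ℤ) - 1) =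
      placementWeight w (board n h) P * (∏ j ∈ Finset.Icc 1 (n - P.card), V ((j : ℤ) - 1)) *
        V ((n : ℤ) - h (n + 1)) := by
  obtain ⟨hPB, hPN⟩ := mem_allPlacements.1 hP
  have hnot : ∀ j, (n + 1, j) ∉ P := fun j hj => by
    have := (mem_board.1 (hPB hj)).1.2
    simp at this
  have hcard := card_le_of_mem_allPlacements hP
  have hfree := card_freeRows_add_card hP hmono
  set H := h (n + 1) with hH
  set F := freeRows H P with hF
  let g : ℕ → R := fun t => w (((n + 1 : ℕ) : ℤ) - H + t)
  have hg : ∀ j ∈ F, w ((n + 1 : ℕ) - (j : ℤ) - (northWest P (n + 1, j) : ℤ)) =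
      g (F.filter (j < ·)).card := fun j hj => by
    have := northWest_add_card_freeRows hP hmono (mem_freeRows.1 hj).1.2
    rw [← hF] at this
    simp only [g]
    congr 1
    omega
  have hwP : placementWeight w (board (n + 1) h) P =
      placementWeight w (board n h) P * ∏ i ∈ F, g (F.filter (i < ·)).card := by
    rw [placementWeight_board_succ w (uncancelled_board_succ hPB) fun _ _ => rfl]
    congr 1
    exact Finset.prod_congr rfl hg
  have hwj : ∀ j, placementWeight w (board (n + 1) h) (insert (n + 1, j) P) =
      placementWeight w (board n h) P * ∏ i ∈ F with j < i, g (F.filter (i < ·)).card := by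
    intro j
    rw [placementWeight_board_succ w (uncancelled_board_succ_insert hPB)
      fun c hc => northWest_insert_succ hc]
    congr 1
    exact Finset.prod_congr rfl fun i hi => hg i (Finset.mem_filter.1 hi).1
  rw [filter_allPlacements_board_succ hP, Finset.sum_insert, Finset.sum_image]
  · have hlast : ∏ j ∈ Finset.Icc 1 (n + 1 - P.card), V ((j : ℤ) - 1) =
        (∏ j ∈ Finset.Icc 1 (n - P.card), V ((j : ℤ) - 1)) *
          V (((n + 1 : ℕ) : ℤ) - H + F.card - 1) := by
      rw [Nat.succ_sub hcard, Finset.prod_Icc_succ_top (by omega)]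
      congr 2
      omega
    have hins : ∀ j, n + 1 - (insert (n + 1, j) P).card = n - P.card := fun j => by
      rw [Finset.card_insert_of_notMem (hnot j)]
      omega
    simp only [hwj, hins, hwP, hlast]
    have hsum := sum_prod_filter_lt_add g (V (((n + 1 : ℕ) : ℤ) - H + F.card - 1)) F
    have hrec := sum_prod_range_add_eq (w := w) (V := V) (l := ((n + 1 : ℕ) : ℤ) - H) (c := F.card)
      fun t ht => by
        have := hV (H - t) (by omega) (by omega)
        rwa [show (((n + 1 : ℕ) : ℤ) - ((H - t : ℕ) : ℤ)) = ((n + 1 : ℕ) : ℤ) - H + t by omega]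
          at this
    rw [hrec] at hsum
    rw [show (n : ℤ) - H = ((n + 1 : ℕ) : ℤ) - H - 1 by push_cast; ring, ← hsum]
    simp only [mul_add, Finset.mul_sum]
    rw [add_comm]
    congr 1
    · exact Finset.sum_congr rfl fun j _ => by ring
    · ring
  · intro j _ k _ hjk
    have hmem : (n + 1, j) ∈ insert (n + 1, k) P := by
      rw [← show insert (n + 1, j) P = insert (n + 1, k) P from hjk]
      exact Finset.mem_insert_self _ _
    rcases Finset.mem_insert.1 hmem with h1 | h1
    · simpa using h1
    · exact absurd h1 (hnot j)
  · intro hmem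
    obtain ⟨j, -, hj⟩ := Finset.mem_image.1 hmem
    exact hnot j (hj ▸ Finset.mem_insert_self _ _)

/-- The product formula for any weight `w` and any sequence `V` with
`V (l - 1) = 1 + w l * V l` at the arguments `l = i - j` for the cells `(i, j)` of the board. -/
theorem sum_placementWeight_mul_prod {R : Type*} [CommRing R] {w V : ℤ → R} {n : ℕ} {h : ℕ → ℕ}
    (hmono : MonotoneOn h (Set.Icc 1 n))
    (hV : ∀ c ∈ board n h,
      V ((c.1 : ℤ) - c.2 - 1) = 1 + w ((c.1 : ℤ) - c.2) * V ((c.1 : ℤ) - c.2)) :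
    ∑ P ∈ allPlacements (board n h), placementWeight w (board n h) P *
        ∏ j ∈ Finset.Icc 1 (n - P.card), V ((j : ℤ) - 1) =
      ∏ i ∈ Finset.Icc 1 n, V ((i : ℤ) - 1 - h i) := by
  induction n with
  | zero =>
    have h0 : board 0 h = ∅ := rfl
    have h1 : allPlacements ∅ = {∅} := by
      ext P
      rw [mem_allPlacements, Finset.subset_empty, Finset.mem_singleton]
      exact ⟨And.left, fun hP => ⟨hP, by simp [Nonattacking, hP]⟩⟩
    simp [h0, h1, placementWeight, uncancelled]
  | succ n ih =>
    have hsub : board n h ⊆ board (n + 1) h := fun c hc => by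
      rw [mem_board] at hc ⊢
      omega
    rw [Finset.prod_Icc_succ_top (by omega), ← ih
      (hmono.mono (Set.Icc_subset_Icc_right (by omega))) fun c hc => hV c (hsub hc),
      Finset.sum_mul]
    have hmaps : ∀ Q ∈ allPlacements (board (n + 1) h),
        Q.filter (fun c => c.1 ≤ n) ∈ allPlacements (board n h) := fun Q hQ => by
      obtain ⟨hQB, hQN⟩ := mem_allPlacements.1 hQ
      refine mem_allPlacements.2 ⟨fun c hc => ?_, hQN.subset (Finset.filter_subset _ _)⟩
      have hc := Finset.mem_filter.1 hc
      have := mem_board.1 (hQB hc.1)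
      exact mem_board.2 ⟨⟨this.1.1, hc.2⟩, this.2⟩
    rw [← Finset.sum_fiberwise_of_maps_to hmaps]
    refine Finset.sum_congr rfl fun P hP => ?_
    rw [sum_extensions hP (fun i hi hin => hmono ⟨hi, by omega⟩ ⟨by omega, le_rfl⟩ (by omega))
      fun j hj hjH => hV (n + 1, j) (mem_board.2 ⟨⟨by simp, le_rfl⟩, hj, hjH⟩)]
    push_cast
    rw [add_sub_cancel_right]

/-! ### The recurrence of the elliptic numbers -/

/-- The elliptic number `[z - l]` with parameters shifted by `l`. The factors on both sides of the
product formula are all of this form. -/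
def shiftedNumber (a b q p z : ℂ) (l : ℤ) : ℂ :=
  number (a * q ^ (2 * l)) (b * q ^ l) q p (z - l)

lemma number_eq_shiftedNumber {a b q p z s : ℂ} {l : ℤ} (h : s = z - l) :
    number (a * q ^ (2 * l)) (b * q ^ l) q p s = shiftedNumber a b q p z l := by
  rw [h, shiftedNumber]

/-- Two of the four factors of the denominator do not depend on the shift. -/
lemma numberDen_shift {a b q p z : ℂ} (hq : q ≠ 0) (l : ℤ) :
    numberDen (a * q ^ (2 * l)) (b * q ^ l) q p (z - l) =
      theta q p * theta (a * q ^ (2 * l + 1)) p * theta (b * q ^ (z + 1)) p *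
        theta (a * q ^ (z - 1) / b) p := by
  have hl := zpow_ne_zero l hq
  have h1 : a * q ^ (2 * l) * q = a * q ^ (2 * l + 1) := by
    rw [zpow_add_one₀ hq, mul_assoc]
  have h2 : b * q ^ l * q ^ (z - l + 1) = b * q ^ (z + 1) := by
    rw [show z - l + 1 = z + 1 - l by ring, Complex.cpow_sub _ _ hq, Complex.cpow_intCast]
    field_simp
  have h3 : a * q ^ (2 * l) * q ^ (z - l - 1) / (b * q ^ l) = a * q ^ (z - 1) / b := by
    rw [show z - l - 1 = z - 1 - l by ring, Complex.cpow_sub _ _ hq, Complex.cpow_intCast, two_mul,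
      zpow_add₀ hq]
    field_simp
  rw [numberDen, h1, h2, h3]

/-- The recurrence `[z - l + 1] = 1 + w(l) [z - l]` of the elliptic numbers with parameters
shifted by `l - 1` and `l`. It is the addition formula divided by the common denominator. -/
lemma shiftedNumber_sub_one {a b q p z : ℂ} {l : ℤ} (ha : a ≠ 0) (hb : b ≠ 0) (hq : q ≠ 0)
    (hp : ‖p‖ < 1) (hw : weightDen a b q p l ≠ 0)
    (hn : numberDen (a * q ^ (2 * l)) (b * q ^ l) q p (z - l) ≠ 0) :
    shiftedNumber a b q p z (l - 1) = 1 + weight a b q p l * shiftedNumber a b q p z l := by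
  have hl := zpow_ne_zero l hq
  have hy : q ^ (z - l) ≠ 0 := by simp [Complex.cpow_eq_zero_iff, hq]
  rw [shiftedNumber, shiftedNumber, number, number, numberDen_shift hq, weight, numberDen_shift hq]
  rw [numberDen_shift hq] at hn
  rw [weightDen] at hw ⊢
  have e1 : q ^ (z + 1) = q ^ l * q * q ^ (z - l) := by
    rw [Complex.cpow_sub _ _ hq, Complex.cpow_add _ _ hq, Complex.cpow_intCast, Complex.cpow_one]
    field_simp
  have e2 : q ^ (z - 1) = q ^ l / q * q ^ (z - l) := by
    rw [Complex.cpow_sub _ _ hq, Complex.cpow_sub _ _ hq, Complex.cpow_intCast, Complex.cpow_one]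
    field_simp
  have e3 : q ^ (z - ((l - 1 : ℤ) : ℂ)) = q * q ^ (z - l) := by
    rw [show z - ((l - 1 : ℤ) : ℂ) = 1 + (z - l) by push_cast; ring, Complex.cpow_add _ _ hq,
      Complex.cpow_one]
  rw [e1, e2] at hn ⊢
  rw [e3]
  set y := q ^ (z - l)
  set u := q ^ l with hu
  have f1 : q ^ (2 * l) = u ^ 2 := by rw [hu, ← zpow_natCast, ← zpow_mul, mul_comm]; rfl
  have f2 : q ^ (2 * (l - 1)) = u ^ 2 / q ^ 2 := by
    rw [mul_sub, zpow_sub₀ hq, f1]; rfl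
  have f3 : q ^ (2 * l + 1) = u ^ 2 * q := by rw [zpow_add_one₀ hq, f1]
  have f4 : q ^ (2 * l - 1) = u ^ 2 / q := by rw [zpow_sub_one₀ hq, f1]; rfl
  have f5 : q ^ (l - 1) = u / q := by rw [zpow_sub_one₀ hq]; rfl
  have f6 : q ^ (l + 2) = u * q ^ 2 := by rw [zpow_add₀ hq]; rfl
  have f7 : q ^ (l - 2) = u / q ^ 2 := by rw [zpow_sub₀ hq]; rfl
  have f8 : q ^ (2 * (l - 1) + 1) = u ^ 2 / q := by rw [← f4]; congr 1; ring
  rw [f3] at hn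
  rw [f4, f6] at hw
  rw [f1, f2, f3, f4, f5, f6, f7, f8]
  have g1 : a * u ^ 2 / (b * u) = a * u / b := by field_simp
  have g2 : a * (u ^ 2 / q ^ 2) * (q * y) = a * u ^ 2 / q * y := by field_simp
  have g3 : b * (u / q) * q ^ 2 = b * u * q := by field_simp
  have g4 : a * (u ^ 2 / q ^ 2) / (b * (u / q)) = a * u ^ 2 / q / (b * u) := by field_simp
  have g5 : a * (u / q * y) / b = a * u ^ 2 / q / (b * u) * y := by field_simp
  have g6 : b * (u * q * y) = b * u * q * y := by ring
  have g7 : a * u ^ 2 * y = a * u ^ 2 / q * q * y := by field_simp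
  have g8 : a * (u / q ^ 2) / b = a * u ^ 2 / q / (b * u * q) := by field_simp
  have g9 : a * (u ^ 2 / q) = a * u ^ 2 / q := by ring
  have g10 : b * u * q ^ 2 = b * (u * q ^ 2) := by ring
  rw [g5, g6] at hn ⊢
  rw [g9] at hw ⊢
  rw [g1, g2, g3, g4, g7, g8, g10]
  simp only [ne_eq, mul_eq_zero, not_or] at hn hw
  obtain ⟨⟨⟨hn1, hn2⟩, hn3⟩, hn4⟩ := hn
  obtain ⟨⟨hw1, hw2⟩, hw3⟩ := hw
  have key := theta_addition (y := y) (c := a * u ^ 2 / q) (d := b * u) hp hq hy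
    (by positivity) (mul_ne_zero hb hl) hn1 hw1
  rw [div_eq_iff (mul_ne_zero (mul_ne_zero (mul_ne_zero hn1 hw1) hn3) hn4), key]
  generalize theta (a * u ^ 2 / q / (b * u) * y) p = t1 at *
  generalize theta (a * u ^ 2 / q) p = t2 at *
  generalize theta (b * (u * q ^ 2)) p = t3 at *
  generalize theta (a * u / b) p = t4 at *
  generalize theta (a * (u ^ 2 * q)) p = t5 at *
  generalize theta (b * u * q * y) p = t6 at *
  generalize theta q p = t7 at *
  field_simp

/-! ### The product formula for elliptic rook numbers -/

lemma rookNumber_eq_sum_allPlacements (a b q p : ℂ) (k : ℕ) (B : Finset (ℕ × ℕ)) :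
    rookNumber a b q p k B =
      ∑ P ∈ allPlacements B with P.card = k, placementWeight (weight a b q p) B P := by
  refine Finset.sum_congr ?_ fun P _ => rfl
  ext P
  simp only [placements, allPlacements, Finset.mem_filter, Finset.mem_powersetCard,
    Finset.mem_powerset]
  tauto

end EllipticRook

end

theorem mainTheorem2 (a b q p z : ℂ) (n : ℕ) (h : ℕ → ℕ)
    (ha : a ≠ 0) (hb : b ≠ 0) (hq : q ≠ 0) (hp : ‖p‖ < 1)
    -- `h 1 ≤ h 2 ≤ ⋯ ≤ h n ≤ n` are the column heights of the board
    (hmono : MonotoneOn h (Set.Icc 1 n))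
    (hle : ∀ i ∈ Finset.Icc 1 n, h i ≤ n)
    -- no denominator in the identity vanishes
    (hdenL : ∀ i ∈ Finset.Icc 1 n,
      EllipticRook.numberDen (a * q ^ (2 * ((i : ℤ) - 1 - (h i : ℤ))))
        (b * q ^ ((i : ℤ) - 1 - (h i : ℤ))) q p (z + (h i : ℂ) - (i : ℂ) + 1) ≠ 0)
    (hdenR : ∀ j ∈ Finset.Icc 1 n,
      EllipticRook.numberDen (a * q ^ (2 * ((j : ℤ) - 1)))
        (b * q ^ ((j : ℤ) - 1)) q p (z - (j : ℂ) + 1) ≠ 0)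
    (hdenW : ∀ c ∈ EllipticRook.board n h,
      EllipticRook.weightDen a b q p ((c.1 : ℤ) - (c.2 : ℤ)) ≠ 0) :
    ∏ i ∈ Finset.Icc 1 n,
      EllipticRook.number (a * q ^ (2 * ((i : ℤ) - 1 - (h i : ℤ))))
        (b * q ^ ((i : ℤ) - 1 - (h i : ℤ))) q p (z + (h i : ℂ) - (i : ℂ) + 1) =
    ∑ k ∈ Finset.range (n + 1),
      EllipticRook.rookNumber a b q p (n - k) (EllipticRook.board n h) *
        ∏ j ∈ Finset.Icc 1 k,
          EllipticRook.number (a * q ^ (2 * ((j : ℤ) - 1)))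
            (b * q ^ ((j : ℤ) - 1)) q p (z - (j : ℂ) + 1) := by
  open EllipticRook in
  have hL : ∀ i : ℕ, number (a * q ^ (2 * ((i : ℤ) - 1 - (h i : ℤ))))
      (b * q ^ ((i : ℤ) - 1 - (h i : ℤ))) q p (z + (h i : ℂ) - (i : ℂ) + 1) =
        shiftedNumber a b q p z ((i : ℤ) - 1 - h i) := fun i =>
    number_eq_shiftedNumber (by push_cast; ring)
  have hR : ∀ j : ℕ, number (a * q ^ (2 * ((j : ℤ) - 1))) (b * q ^ ((j : ℤ) - 1)) q p
      (z - (j : ℂ) + 1) = shiftedNumber a b q p z ((j : ℤ) - 1) := fun j =>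
    number_eq_shiftedNumber (by push_cast; ring)
  have hdenR' : ∀ j : ℕ, 1 ≤ j → j ≤ n → theta q p * theta (a * q ^ (2 * ((j : ℤ) - 1) + 1)) p *
      theta (b * q ^ (z + 1)) p * theta (a * q ^ (z - 1) / b) p ≠ 0 := fun j hj hjn => by
    rw [← numberDen_shift hq, show z - (((j : ℤ) - 1 : ℤ) : ℂ) = z - (j : ℂ) + 1 by push_cast; ring]
    exact hdenR j (Finset.mem_Icc.2 ⟨hj, hjn⟩)
  have hrec : ∀ c ∈ board n h, shiftedNumber a b q p z ((c.1 : ℤ) - c.2 - 1) =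
      1 + weight a b q p ((c.1 : ℤ) - c.2) * shiftedNumber a b q p z ((c.1 : ℤ) - c.2) := by
    rintro ⟨i, j⟩ hc
    obtain ⟨⟨hi, hin⟩, hj, hjh⟩ := mem_board.1 hc
    refine shiftedNumber_sub_one ha hb hq hp (hdenW _ hc) ?_
    rw [numberDen_shift hq]
    have hi' := hdenR' i hi hin
    -- The factor depending on the cell occurs in the weight of the cell below, or, in the bottom
    -- row, in the `i`-th factor on the right-hand side.
    have hθ : theta (a * q ^ (2 * ((i : ℤ) - j) + 1)) p ≠ 0 := by
      rcases Nat.eq_or_lt_of_le hj with rfl | hj'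
      · exact right_ne_zero_of_mul (left_ne_zero_of_mul (left_ne_zero_of_mul hi'))
      · have hbelow := hdenW (i, j - 1) (mem_board.2 ⟨⟨hi, hin⟩, by simp only at *; omega⟩)
        have he : 2 * (((i, j - 1).1 : ℤ) - ((i, j - 1).2 : ℤ)) - 1 = 2 * ((i : ℤ) - j) + 1 := by
          simp only at *
          omega
        rw [weightDen, he] at hbelow
        exact left_ne_zero_of_mul (left_ne_zero_of_mul hbelow)
    simp only [ne_eq, mul_eq_zero, not_or] at hi' ⊢
    exact ⟨⟨⟨hi'.1.1.1, hθ⟩, hi'.1.2⟩, hi'.2⟩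
  simp only [hL, hR]
  rw [← sum_placementWeight_mul_prod hmono hrec, ← Finset.sum_flip,
    ← Finset.sum_fiberwise_of_maps_to (g := Finset.card) (t := Finset.range (n + 1)) fun P hP =>
      Finset.mem_range.2 (Nat.lt_succ_of_le (card_le_of_mem_allPlacements hP))]
  refine Finset.sum_congr rfl fun k hk => ?_
  rw [Nat.sub_sub_self (Nat.le_of_lt_succ (Finset.mem_range.1 hk)),
    rookNumber_eq_sum_allPlacements, Finset.sum_mul]
  refine Finset.sum_congr rfl fun P hP => ?_
  rw [(Finset.mem_filter.1 hP).2]
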